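/- Let $N$ be a positive integer. Then there are integers $a$ and $M\ge 1$ such that every element of the residue class $a(M)=\{x\in\mathbb Z: x\equiv a \pmod M\}$ is odd, and such that for every nonnegative $x\in a(M)$, every $m\in\{1,\dots,N\}$ divisible by none of $3,5,7,11,13$, and every integer $n\ge 0$, the integer $x^m-2^n$ is nonzero and has at least two distinct prime factors. -/

import Mathlib

/-!
# Odd numbers whose powers differ from powers of two by numbers with two prime factors

The integers are covered by finitely many residue classes `a (mod n)` with `n ∣ 3³·5²·7·11·13`,
together with pairwise coprime numbers `P > 1` such that `P ∣ 2 ^ n - 1`. If `x ≡ 2 ^ a (mod P)` for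
every class, then for `m` prime to `15015` each `x ^ m - 2 ^ n` is divisible by one of the `P`.
The condition `x ≡ 1 (mod 6)` provides the second prime factor `3` when `n` is even. When `n` is
odd, `x ≡ 0 (mod q)` with `q = 1 + 12 ∏ P` does: the Jacobi symbol modulo `q` is `1` at `-1` and at
every prime factor of the `P`, but `-1` at `2`, so `x ^ m - 2 ^ n` is not of the form `± p ^ k`.
-/

/-- A cover of the integers by residue classes with odd moduli. The entry `(n, a, P)` stands for the
class of `a` modulo `n`, and `P` is a divisor of `2 ^ n - 1`. -/
def oddCover : List (ℕ × ℕ × ℕ) :=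
  [(3, 0, 7), (5, 3, 31), (7, 2, 127), (9, 1, 73), (11, 7, 23), (11, 10, 89), (13, 11, 8191),
   (15, 2, 151), (21, 8, 337), (25, 9, 601), (25, 19, 1801), (27, 4, 262657), (33, 23, 599479),
   (35, 21, 71), (35, 31, 122921), (39, 4, 79), (39, 22, 121369), (45, 7, 631), (45, 25, 23311),
   (55, 0, 881), (55, 30, 3191), (55, 35, 201961), (63, 5, 92737), (63, 47, 649657),
   (65, 44, 145295143558111), (75, 14, 100801), (75, 74, 10567201), (77, 27, 581283643249112959),
   (91, 32, 911), (91, 60, 112901153), (91, 81, 23140471537), (99, 4, 199), (99, 58, 153649),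
   (99, 94, 33057806959), (105, 11, 29191), (105, 41, 106681), (105, 80, 152041), (117, 7, 937),
   (117, 25, 6553), (117, 79, 86113), (117, 88, 7830118297), (135, 22, 271), (135, 35, 348031),
   (135, 67, 49971617830801), (143, 119, 724153), (143, 130, 918341640732368176049831894647),
   (165, 50, 2048568835297380486760231), (175, 104, 39551), (175, 129, 60816001),
   (175, 154, 535347624791488552837151), (189, 26, 1560007),
   (189, 152, 207617485544258392970753527), (195, 31, 134304196845099262572814573351),
   (225, 49, 115201), (225, 124, 617401), (225, 139, 1348206751), (225, 214, 13861369826299351),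
   (231, 146, 463), (231, 203, 4982397651178256151338302204762057), (273, 211, 108749551),
   (273, 229, 356017128048164475524315650309423081),
   (275, 240, 1556721276769806230717396637223747573860751059022289863442401), (297, 67, 8950393),
   (297, 265, 170886618823141738081830950807292771648313599433), (315, 61, 870031),
   (315, 106, 983431), (315, 286, 29728307155963706810228435378401), (325, 54, 7151),
   (325, 104, 51879585551), (325, 129, 4613679391936953610429590532014122532260339739644049093601),
   (351, 40, 446473), (351, 157, 29121769),
   (351, 202, 8083827781153038849833872032071181582585664937829073), (385, 70, 55441),
   (385, 245, 61233806443677303623560403528692352493069235418799910128093317748271),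
   (495, 290, 991),
   (495, 445, 2033550384106923986575779499248756481316316113263109908459912550138071),
   (525, 95, 4201), (525, 179, 7351), (525, 200, 181165951),
   (525, 305, 325985508875527587669607097222667557116221139090131514801), (585, 166, 2400314671),
   (585, 571, 236319850893578056115975158006020371224120110151352152554969222350407633634311),
   (693, 125, 289511839),
   (693, 356, 9252834409338701668887830884532616637920299359949246671369964807587749940365754998550148340349005079),
   (715, 460, 6044696533794996007639360252721562177012874839270573011027064751580155491084700112603034384569628637306485184999655300335945409092419284861921311),
   (819, 340, 12650299447267491826533294064116970612959399675009711990389433574425084809909135216265299465844782470683419861764133214147374481481),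
   (825, 185, 2665466835736589336028621648642361364028679739142450730117913583430776746419761191608881111835010199620394556043342906401),
   (945, 656, 11112382566050265046201267311127854032287645974415860346290590498168586174867795883723807322077777737613405896828278368924739043841),
   (975, 604, 1951), (1001, 328, 6007),
   (1001, 944, 1820949348989208563134934454867370417241731442757253769027660122025220531154643424727557175913816984478330956518484750019883125787765755778716216864601050903144122991701474321184972747689246938140437077841940203833),
   (1155, 20, 2311), (1155, 350, 6250631311),
   (1155, 830, 128537314863753502326118655961517005161780888023283339978729716802304575118516152684044834454596092941025778051587717899465180571391),
   (1287, 526, 216217), (1287, 1021, 71477407),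
   (1287, 1219, 407081285965605409770883888488316114191201150607135682181516892878051132582051522900229596548857883113435092877075456003561324676711962675764042031066210159106293005304703339910853393427466292198959498799),
   (1365, 676, 469561),
   (1365, 796, 313170989766279801661894979472225492666499422342651949670644727444521552722132587407967342816014043259054985613468425330496038215010720570833217168759876844078785890511),
   (1485, 481, 19694071),
   (1485, 616, 280614712010117536903438123635636512785625397138140713641727443016131604862840235074448669858405826021381220416781009759108606787026865735720889767003034021206447176631254390857979562906135954316023609792798151),
   (1575, 404, 82013401), (1755, 526, 3511), (1755, 1066, 1969111),
   (1755, 1471, 5077307353186852961435498362852277546733324415528530952247270469245957509757710496970995679884621209298871011471729081692752997460362731332081181601249678688387957637169362942802380760661349480810692551118843411115923048675567403972422023838351671),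
   (1925, 235, 11551), (1925, 410, 13167001), (1925, 1390, 1891705201),
   (1925, 1565, 61776479898130184903611431880548748593280783356683302239755967038087136868574568342031089332999678389587817815776688724818491550676294187625490486778683826252214296166635333055683436693942327353188016267431626543889903171648076985066987150764972410453415981267216886756718444812193593474027329472582575595134944331067768732059604133740908551),
   (2079, 211, 4159), (2079, 1399, 16633), (2079, 1534, 80932047967),
   (2079, 1993, 2318271715544956860688509132692025669730751361521542498097015714107616729828038420650876143410664732782559744326911159090462184041662793831858082991897461075821360912094946076269801143838885560327915837492683292919714443410040675519743108217538214610000509604493101531897564191863485609145771044129464928489),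
   (2145, 1615, 96001053721),
   (2145, 1780, 59913121449801362745465396773148353730285772854703747420916830588725706578870149666852029971918617532482225852388132700846638084736669881891567979699758603910201520434203565443959256820292198035311117918659051905237704357012971565338678738298553125044505177630218407382807865391),
   (2275, 554, 218401), (2275, 1979, 28319200001), (2457, 319, 565111), (2457, 580, 1410319),
   (2457, 886, 21287449), (2457, 1147, 41194063),
   (2457, 1282, 1955753296556513150740080368792515408478360942739402785022297391634114304547641394544600817860842146729562725631592201795582649104887157940279272735541560285533746693078634524121366634494645871532727095979369010720985532151222690738713122752093037345711412695464433634888460585420992100123501904830767117319782233019563532623901022856195367318780383658638239852287),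
   (2475, 625, 4951), (2475, 679, 143551),
   (2475, 1804, 24227516725249706243064073648639461252303167372644042235681063088781832001367152713738269566094845497600190042425691147096658235004734318690498251159502083809844943823167200801479816770094204259413796141181054128792543252587011173674623469493540164101097965343458397854442599499475491650870904751514221452615612137408075844177141391712174463450219571801),
   (2925, 1804, 17551),
   (2925, 2335, 1733425350941304068842205455789056965878829146918146681560531203995610615276081564144485216172849750188822981773174865574780586398471779106275538284446300144601241376117543008802201167070058982302229538954343234827024503437538296759321121168611665400295331446349489117879832227264759494569431095047070610707849516231798973145764454903159124478836025333777802665426586315124830689949792768180928089121926317762899859423413134154351),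
   (3003, 2374, 17531814883549414548406598404218444062327738380958843540227464914758936481116002660572732429465333839434215789339291615451571806414791652698190195372824153016282755304718730269730893728107740261292337802279085042799086840906845629995477287639599349224026716345195953549060785023004143841700863369477821935097878626978374804668329453662117828715746015430684147140670427112527364767074803049853308970320142016260857934633916522178847031),
   (3465, 3316, 7983361), (3575, 1230, 124326802601),
   (3575, 1945, 2461575157765391271447254614467816862726651797712285963599875724140871935868855949495000727355851724272136523554263769114383477863283555230096567785957844146867522641862624192051986665081097930879966321262742167558400705106850327123183819384506964044408638268463736554150262543989325467105784710621719846983607884890753846275557159919495508065078197888595451822375046750163098952558301568238227668043440578639906082188477192067444210527045856930680022786147153607198595387829592922165361645522809249911924351298053971303861015286465608908669024996777018150699282848018100738402095747570555963023312215344868351577161308661349410523843865174370190378383164309922096659174687977507199873956399830819629210637846201),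
   (3861, 2425, 168127862582722356797743011570679336720359434288322907121111022497485945806489470047873684578383922926285483512514519834010323919416619493440800265408594533473805961355408533095785518744505417970106998472405414701923720296009292815407708209470841270299487199569666602493037990325384411350177844826590777286964245094031509635490091922295365199365005180633646032365853184369154575269398467135910169519311245988199761008627881487276620966994274756067081566013462910040863760231807605965534961571920621536738117093146391237873689253294846260138492095672052591997797974204678338394973629009175738084521927170549878946392000928141395810870654062666086351361)]

/-- The number whose binary digits are the indicator of the class of `a` modulo `n` on `[0, L)`,
when `a < n` and `n ∣ L`. -/
def residueMask (L a n : ℕ) : ℕ := 2 ^ a * ((2 ^ L - 1) / (2 ^ n - 1))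

theorem dvd_of_testBit_geom {n : ℕ} (hn : 0 < n) (k : ℕ) :
    ∀ {i : ℕ}, ((2 ^ (n * k) - 1) / (2 ^ n - 1)).testBit i = true → n ∣ i := by
  have hpos : 0 < 2 ^ n - 1 := by
    have := Nat.one_lt_two_pow hn.ne'
    omega
  induction k with
  | zero => simp
  | succ k ih =>
    intro i hi
    have hsplit : (2 ^ (n * (k + 1)) - 1) / (2 ^ n - 1)
        = 2 ^ n * ((2 ^ (n * k) - 1) / (2 ^ n - 1)) + 1 := by
      obtain ⟨g, hg⟩ : 2 ^ n - 1 ∣ 2 ^ (n * k) - 1 := by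
        rw [pow_mul]
        simpa using Nat.sub_dvd_pow_sub_pow (2 ^ n) 1 k
      rw [hg, Nat.mul_div_cancel_left _ hpos]
      refine Nat.div_eq_of_eq_mul_right hpos ?_
      have h1 : 1 ≤ 2 ^ n := Nat.one_le_two_pow
      have h2 : 1 ≤ 2 ^ (n * k) := Nat.one_le_two_pow
      have h3 : 1 ≤ 2 ^ (n * (k + 1)) := Nat.one_le_two_pow
      zify [h1, h2, h3] at hg ⊢
      rw [mul_add, pow_add, mul_one]
      linear_combination (2 : ℤ) ^ n * hg
    rw [hsplit, Nat.testBit_two_pow_mul_add _ (Nat.one_lt_two_pow hn.ne')] at hi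
    split_ifs at hi with h
    · rw [Nat.testBit_one_eq_true_iff_self_eq_zero] at hi
      simp [hi]
    · have := ih hi
      obtain ⟨j, hj⟩ := this
      exact ⟨j + 1, by rw [mul_add, ← hj]; omega⟩

theorem modEq_of_testBit_residueMask {L a n i : ℕ} (hn : 0 < n) (hnL : n ∣ L)
    (h : (residueMask L a n).testBit i = true) : i ≡ a [MOD n] := by
  obtain ⟨k, rfl⟩ := hnL
  rw [residueMask, Nat.testBit_two_pow_mul, Bool.and_eq_true, decide_eq_true_eq] at h
  exact ((Nat.modEq_iff_dvd' h.1).2 (dvd_of_testBit_geom hn k h.2)).symm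

theorem exists_mem_testBit_of_foldr {α : Type*} (f : α → ℕ) (i : ℕ) (l : List α) :
    (l.foldr (fun c u => f c ||| u) 0).testBit i = true → ∃ c ∈ l, (f c).testBit i = true := by
  induction l with
  | nil => simp
  | cons c l ih =>
    simp only [List.foldr_cons, Nat.testBit_or, Bool.or_eq_true]
    rintro (h | h)
    · exact ⟨c, by simp, h⟩
    · obtain ⟨c', hc', h'⟩ := ih h
      exact ⟨c', by simp [hc'], h'⟩

theorem oddCover_dvd : ∀ c ∈ oddCover,
    0 < c.1 ∧ c.1 ∣ 675675 ∧ 1 < c.2.2 ∧ c.2.2 ∣ 2 ^ c.1 - 1 := by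
  decide +kernel

theorem oddCover_pairwise_coprime : oddCover.Pairwise fun c c' => c.2.2.Coprime c'.2.2 := by
  decide +kernel

theorem oddCover_coprime_six : ∀ c ∈ oddCover, Nat.Coprime 6 c.2.2 := by
  decide +kernel

theorem oddCover_foldr_residueMask :
    oddCover.foldr (fun c u => residueMask 675675 c.2.1 c.1 ||| u) 0 = 2 ^ 675675 - 1 := by
  decide +kernel

theorem exists_mem_oddCover_modEq (t : ℕ) : ∃ c ∈ oddCover, t ≡ c.2.1 [MOD c.1] := by
  have hbit : (2 ^ 675675 - 1).testBit (t % 675675) = true := by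
    rw [Nat.testBit_two_pow_sub_one]
    simpa using Nat.mod_lt t (by norm_num)
  rw [← oddCover_foldr_residueMask] at hbit
  obtain ⟨c, hc, h⟩ := exists_mem_testBit_of_foldr _ _ _ hbit
  obtain ⟨hpos, hdvd, -⟩ := oddCover_dvd c hc
  exact ⟨c, hc, ((Nat.mod_modEq t 675675).symm.of_dvd hdvd).trans
    (modEq_of_testBit_residueMask hpos hdvd h)⟩

/-- Multiplication by a number prime to all moduli maps the cover to another cover. -/
theorem exists_mem_oddCover_mul_modEq {m : ℕ} (hm : m.Coprime 675675) (n : ℕ) :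
    ∃ c ∈ oddCover, m * c.2.1 ≡ n [MOD c.1] := by
  obtain ⟨s, -, hs⟩ := Nat.exists_mul_mod_eq_one_of_coprime hm (by norm_num)
  obtain ⟨c, hc, h⟩ := exists_mem_oddCover_modEq (s * n)
  refine ⟨c, hc, ?_⟩
  have hs' : m * s ≡ 1 [MOD 675675] := by rw [Nat.ModEq, hs]
  have h1 : m * (s * n) ≡ n [MOD 675675] := by
    simpa [mul_assoc] using hs'.mul_right n
  exact (h.mul_left m).symm.trans (h1.of_dvd (oddCover_dvd c hc).2.1)

theorem two_pow_modEq_of_modEq {P d i j : ℕ} (hP : P ∣ 2 ^ d - 1) (h : i ≡ j [MOD d]) :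
    2 ^ i ≡ 2 ^ j [MOD P] := by
  have h1 : 2 ^ d ≡ 1 [MOD P] := ((Nat.modEq_iff_dvd' Nat.one_le_two_pow).2 hP).symm
  have key : ∀ k : ℕ, 2 ^ k ≡ 2 ^ (k % d) [MOD P] := fun k => by
    conv_lhs => rw [← Nat.div_add_mod k d, pow_add, pow_mul]
    simpa using (h1.pow (k / d)).mul_right (2 ^ (k % d))
  have hij : i % d = j % d := h
  exact (key i).trans (hij ▸ (key j).symm)

/-- A modulus for which `-1` and all prime factors of `Q` have Jacobi symbol `1`, while `2` has
Jacobi symbol `-1`. -/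
theorem jacobiSym_one_add_twelve_mul {Q : ℕ} (hQ : Odd Q) :
    jacobiSym (-1) (1 + 12 * Q) = 1 ∧ jacobiSym 2 (1 + 12 * Q) = -1 ∧
      ∀ p : ℕ, p ∣ Q → jacobiSym p (1 + 12 * Q) = 1 := by
  obtain ⟨k, rfl⟩ := hQ
  have hodd : Odd (1 + 12 * (2 * k + 1)) := ⟨12 * k + 6, by ring⟩
  refine ⟨?_, ?_, fun p hp => ?_⟩
  · rw [jacobiSym.at_neg_one hodd, ZMod.χ₄_nat_one_mod_four (by omega)]
  · rw [jacobiSym.at_two hodd, ZMod.χ₈_nat_eq_if_mod_eight]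
    have h2 : (1 + 12 * (2 * k + 1)) % 2 = 1 := by omega
    have h8 : (1 + 12 * (2 * k + 1)) % 8 = 5 := by omega
    simp [h2, h8]
  · have hpodd : Odd p := Odd.of_dvd_nat ⟨k, rfl⟩ hp
    rw [jacobiSym.quadratic_reciprocity_one_mod_four' hpodd (by omega)]
    obtain ⟨r, hr⟩ := hp
    rw [hr, jacobiSym.mod_left]
    have : ((1 + 12 * (p * r) : ℕ) : ℤ) % p = 1 % p := by
      push_cast
      rw [show (1 + 12 * ((p : ℤ) * r)) = 1 + p * (12 * r) by ring, Int.add_mul_emod_self_left]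
    rw [this, ← jacobiSym.mod_left, jacobiSym.one_left]

theorem two_le_card_primeFactors_sub_two_pow {Q : ℕ} (hQ : Nat.Coprime 6 Q) {x : ℤ}
    (hx6 : x ≡ 1 [ZMOD 6]) (hxq : ((1 + 12 * Q : ℕ) : ℤ) ∣ x) {m n p : ℕ} (hm : m ≠ 0)
    (hp : p.Prime) (hpQ : p ∣ Q) (hpx : (p : ℤ) ∣ x ^ m - 2 ^ n) :
    x ^ m - 2 ^ n ≠ 0 ∧ 2 ≤ (x ^ m - 2 ^ n).natAbs.primeFactors.card := by
  have hQodd : Odd Q := (Nat.Coprime.coprime_dvd_left (by norm_num : 2 ∣ 6) hQ).odd_of_left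
  obtain ⟨hneg, htwo, hJp⟩ := jacobiSym_one_add_twelve_mul hQodd
  have hJ : jacobiSym (x ^ m - 2 ^ n) (1 + 12 * Q) = (-1) ^ n := by
    have : (x ^ m - 2 ^ n) % ((1 + 12 * Q : ℕ) : ℤ) = (-1 * 2 ^ n) % ((1 + 12 * Q : ℕ) : ℤ) := by
      refine Int.ModEq.symm ((Int.modEq_iff_dvd).2 ?_)
      rw [show x ^ m - 2 ^ n - -1 * 2 ^ n = x ^ m by ring]
      exact dvd_pow hxq hm
    rw [jacobiSym.mod_left, this, ← jacobiSym.mod_left, jacobiSym.mul_left, hneg, one_mul,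
      jacobiSym.pow_left, htwo]
  have hQpos : 0 < Q := hQodd.pos
  have hne : x ^ m - 2 ^ n ≠ 0 := fun h0 => by
    rw [h0, jacobiSym.zero_left (by omega)] at hJ
    exact pow_ne_zero n (by norm_num : (-1 : ℤ) ≠ 0) hJ.symm
  refine ⟨hne, ?_⟩
  have hne' : (x ^ m - 2 ^ n).natAbs ≠ 0 := Int.natAbs_ne_zero.2 hne
  have hpmem : p ∈ (x ^ m - 2 ^ n).natAbs.primeFactors :=
    Nat.mem_primeFactors.2 ⟨hp, Int.natCast_dvd.1 hpx, hne'⟩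
  rcases Nat.even_or_odd n with hn | hn
  · have h3 : (3 : ℤ) ∣ x ^ m - 2 ^ n := by
      have hx3 : x ^ m ≡ 1 [ZMOD 3] := by
        simpa using (hx6.of_dvd (by norm_num : (3 : ℤ) ∣ 6)).pow m
      have h23 : (2 : ℤ) ^ n ≡ 1 [ZMOD 3] := by
        have h := (show (2 : ℤ) ≡ -1 [ZMOD 3] by decide).pow n
        rwa [hn.neg_one_pow] at h
      exact (h23.trans hx3.symm).dvd
    have h3mem : 3 ∈ (x ^ m - 2 ^ n).natAbs.primeFactors :=
      Nat.mem_primeFactors.2 ⟨Nat.prime_three, Int.natCast_dvd.1 (by exact_mod_cast h3), hne'⟩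
    refine Finset.one_lt_card.2 ⟨3, h3mem, p, hpmem, ?_⟩
    rintro rfl
    exact absurd (Nat.dvd_gcd (by norm_num : 3 ∣ 6) hpQ) (by rw [hQ]; norm_num)
  · by_contra hcard
    have huniq : ∀ {r : ℕ}, r.Prime → r ∣ (x ^ m - 2 ^ n).natAbs → r = p := fun hr hrd =>
      Finset.card_le_one.1 (by omega) _ (Nat.mem_primeFactors.2 ⟨hr, hrd, hne'⟩) _ hpmem
    have hpow := Nat.eq_prime_pow_of_unique_prime_dvd hne' huniq
    set k := (x ^ m - 2 ^ n).natAbs.primeFactorsList.length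
    have hJk : jacobiSym ((p : ℤ) ^ k) (1 + 12 * Q) = 1 := by
      rw [jacobiSym.pow_left, hJp p hpQ, one_pow]
    rw [hn.neg_one_pow] at hJ
    rcases Int.natAbs_eq (x ^ m - 2 ^ n) with h | h
    · rw [h, hpow, Nat.cast_pow, hJk] at hJ
      norm_num at hJ
    · rw [h, hpow, Nat.cast_pow, ← neg_one_mul, jacobiSym.mul_left, hneg, hJk] at hJ
      norm_num at hJ

theorem exists_modEq_of_pairwise_coprime (l : List (ℕ × ℕ × ℕ))
    (hl : l.Pairwise fun c c' => c.2.2.Coprime c'.2.2) :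
    ∃ z : ℕ, ∀ c ∈ l, z ≡ 2 ^ c.2.1 [MOD c.2.2] :=
  ⟨_, (Nat.chineseRemainderOfList (fun c : ℕ × ℕ × ℕ => 2 ^ c.2.1) (fun c => c.2.2) l hl).2⟩

/-- The residue class used in the main theorem, for an arbitrary list of pairwise coprime moduli. -/
theorem exists_residueClass (l : List (ℕ × ℕ × ℕ))
    (hl : l.Pairwise fun c c' => c.2.2.Coprime c'.2.2) (hl6 : ∀ c ∈ l, Nat.Coprime 6 c.2.2) :
    ∃ Q : ℕ, Nat.Coprime 6 Q ∧ (∀ c ∈ l, c.2.2 ∣ Q) ∧ ∃ a M : ℤ, 0 < M ∧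
      ∀ x : ℤ, x ≡ a [ZMOD M] → x ≡ 1 [ZMOD 6] ∧ ((1 + 12 * Q : ℕ) : ℤ) ∣ x ∧
        ∀ c ∈ l, x ≡ 2 ^ c.2.1 [ZMOD c.2.2] := by
  obtain ⟨z, hz⟩ := exists_modEq_of_pairwise_coprime l hl
  set Q := (l.map fun c => c.2.2).prod
  have hdvdQ : ∀ c ∈ l, c.2.2 ∣ Q := fun c hc => List.dvd_prod (List.mem_map_of_mem hc)
  have hQ6 : Nat.Coprime 6 Q := by
    rw [Nat.coprime_list_prod_right_iff]
    intro P hP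
    obtain ⟨c, hc, rfl⟩ := List.mem_map.1 hP
    exact hl6 c hc
  have hQpos : 0 < Q := Nat.pos_of_ne_zero fun h => by simp [h] at hQ6
  have hqQ : Nat.Coprime (1 + 12 * Q) (6 * Q) := by
    rw [show 1 + 12 * Q = 1 + 2 * (6 * Q) by ring]
    simp
  obtain ⟨y, hy6, hyQ⟩ := Nat.chineseRemainder hQ6 1 z
  obtain ⟨a, haq, ha⟩ := Nat.chineseRemainder hqQ 0 y
  refine ⟨Q, hQ6, hdvdQ, a, ((1 + 12 * Q) * (6 * Q) : ℕ), by positivity, fun x hx => ?_⟩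
  have hsub : ∀ {d b : ℕ}, d ∣ (1 + 12 * Q) * (6 * Q) → a ≡ b [MOD d] → x ≡ b [ZMOD d] :=
    fun hd hab => (hx.of_dvd (Int.natCast_dvd_natCast.2 hd)).trans (Int.natCast_modEq_iff.2 hab)
  refine ⟨?_, ?_, fun c hc => ?_⟩
  · exact_mod_cast hsub (d := 6) (b := 1) (dvd_mul_of_dvd_right (dvd_mul_right _ _) _)
      ((ha.of_dvd (dvd_mul_right _ _)).trans hy6)
  · exact Int.modEq_zero_iff_dvd.1 (by exact_mod_cast hsub (dvd_mul_right _ _) haq)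
  · have hcQ := hdvdQ c hc
    have h := hsub (dvd_mul_of_dvd_right (dvd_mul_of_dvd_right hcQ _) _)
      (((ha.of_dvd (dvd_mul_of_dvd_right hcQ _)).trans (hyQ.of_dvd hcQ)).trans (hz c hc))
    exact_mod_cast h

theorem theorem1p2 (N : ℕ) (hN : 0 < N) :
    ∃ a M : ℤ, 0 < M ∧
      (∀ x : ℤ, x ≡ a [ZMOD M] → Odd x) ∧
      ∀ x : ℤ, x ≡ a [ZMOD M] → 0 ≤ x →
        ∀ m : ℕ, 1 ≤ m → m ≤ N →
          ¬ 3 ∣ m → ¬ 5 ∣ m → ¬ 7 ∣ m → ¬ 11 ∣ m → ¬ 13 ∣ m →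
            ∀ n : ℕ,
              x ^ m - 2 ^ n ≠ 0 ∧ 2 ≤ (x ^ m - 2 ^ n).natAbs.primeFactors.card := by
  obtain ⟨Q, hQ6, hdvdQ, a, M, hM, hx⟩ :=
    exists_residueClass oddCover oddCover_pairwise_coprime oddCover_coprime_six
  refine ⟨a, M, hM, fun x hxa => ?_, fun x hxa _ m hm _ h3 h5 h7 h11 h13 n => ?_⟩
  · have h2 : x % 2 = 1 := (hx x hxa).1.of_dvd (by norm_num : (2 : ℤ) ∣ 6)
    exact Int.odd_iff.2 h2
  · obtain ⟨hx6, hxq, hxP⟩ := hx x hxa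
    have hcop : m.Coprime 675675 := by
      rw [show 675675 = 3 ^ 3 * 5 ^ 2 * 7 * 11 * 13 by norm_num]
      have key : ∀ {p : ℕ}, p.Prime → ¬ p ∣ m → m.Coprime p := fun hp h =>
        ((Nat.Prime.coprime_iff_not_dvd hp).2 h).symm
      exact ((((((key Nat.prime_three h3).pow_right 3).mul_right
        ((key Nat.prime_five h5).pow_right 2)).mul_right (key (by norm_num) h7)).mul_right
        (key (by norm_num) h11)).mul_right (key (by norm_num) h13))
    obtain ⟨c, hc, hmn⟩ := exists_mem_oddCover_mul_modEq hcop n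
    obtain ⟨-, -, hP1, hPd⟩ := oddCover_dvd c hc
    have hdvd : (c.2.2 : ℤ) ∣ x ^ m - 2 ^ n := by
      have h1 : x ^ m ≡ 2 ^ (m * c.2.1) [ZMOD c.2.2] := by
        simpa [← pow_mul, mul_comm] using (hxP c hc).pow m
      have h2 : (2 : ℤ) ^ (m * c.2.1) ≡ 2 ^ n [ZMOD c.2.2] := by
        exact_mod_cast Int.natCast_modEq_iff.2 (two_pow_modEq_of_modEq hPd hmn)
      exact (h1.trans h2).symm.dvd
    have hp := Nat.minFac_prime hP1.ne'
    have hpP : c.2.2.minFac ∣ c.2.2 := Nat.minFac_dvd _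
    exact two_le_card_primeFactors_sub_two_pow hQ6 hx6 hxq (by omega) hp
      (hpP.trans (hdvdQ c hc)) ((Int.natCast_dvd_natCast.2 hpP).trans hdvd)
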